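/- Let $d\ge 2$ be a square-free integer and let $T$ be an $s$-interval exchange transformation on $[\ell,r[$ with exchanged semi-intervals $I_1,\dots,I_s$ (from left to right, of positive lengths), defined over $\mathbb{Z}[\sqrt d]$: $\ell$ and all the lengths of the $I_i$ lie in $\mathbb{Z}[\sqrt d]$. Assume that $T$ is minimal, i.e. that the orbit $\{T^n(z) : n\in\mathbb{Z}\}$ of every $z\in[\ell,r[$ is dense in $[\ell,r[$. Let $\mathrm{Sep}(T)=\{\gamma_1=\ell,\gamma_2,\dots,\gamma_s\}$ be the set of left end points of the $I_i$. For integers $m,n\ge 0$ let $$\mathcal{D}_{m,n}(T)=\bigcup_{i=-m+1}^{n}T^i(\mathrm{Sep}(T)),$$ let $\mathcal{U}_{m,n}(T)$ be the family of semi-intervals into which the points of $\mathcal{D}_{m,n}(T)$ cut $[\ell,r[$, i.e. the $[t,w[$ with $t<w$, $t,w\in\mathcal{D}_{m,n}(T)\cup\{\ell,r\}$ and $]t,w[\,\cap\,\mathcal{D}_{m,n}(T)=\emptyset$, and let $\mathcal{U}(T)=\bigcup_{m,n\ge 0}\mathcal{U}_{m,n}(T)$. For $z=a+b\sqrt d$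 with $a,b\in\mathbb{Z}$ put $\Psi(z)=\max(|a|,|b|)$. For a finite union $S\subset[\ell,r[$ of semi-intervals with end points in $\mathbb{Z}[\sqrt d]$ put $\Psi(S)=\max\{\Psi(z) : z\in\partial S\}$ and $\Pi(S)=|S|\,\Psi(S)$, where $\partial S$ is the boundary of $S$ in $\mathbb{R}$ and $|S|$ its Lebesgue measure. Then every $J\in\mathcal{U}(T)$ has its end points in $\mathbb{Z}[\sqrt d]$, and $\Pi(J)=\Theta(1)$ for $J\in\mathcal{U}(T)$: there are constants $c,C>0$, depending only on $T$ and $d$, such that $c\le\Pi(J)\le C$ for every $J\in\mathcal{U}(T)$. -/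

import Mathlib

/-- An `s`-interval exchange transformation: the left end point of its domain, the lengths of the
exchanged semi-intervals (in their order from left to right) and the permutation giving their order
after the exchange. -/
structure IET (s : ℕ) where
  /-- the left end point of the domain -/
  left : ℝ
  /-- the lengths of the exchanged semi-intervals -/
  len : Fin s → ℝ
  len_pos : ∀ i, 0 < len i
  /-- the `i`-th semi-interval is moved to the position `perm i` -/
  perm : Equiv.Perm (Fin s)

namespace IET

variable {s : ℕ}

/-- The right end point of the domain. -/
noncomputable def right (T : IET s) : ℝ := T.left + ∑ i, T.len i

/-- The domain, a semi-interval. -/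
noncomputable def dom (T : IET s) : Set ℝ := Set.Ico T.left T.right

/-- The left end point of the `i`-th exchanged semi-interval. -/
noncomputable def γ (T : IET s) (i : Fin s) : ℝ := T.left + ∑ j with j < i, T.len j

/-- The left end point of the image of the `i`-th exchanged semi-interval. -/
noncomputable def δ (T : IET s) (i : Fin s) : ℝ :=
  T.left + ∑ j with T.perm j < T.perm i, T.len j

/-- The translation values. -/
noncomputable def α (T : IET s) (i : Fin s) : ℝ := T.δ i - T.γ i

/-- The exchanged semi-intervals. -/
noncomputable def I (T : IET s) (i : Fin s) : Set ℝ := Set.Ico (T.γ i) (T.γ i + T.len i)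

open Classical in
/-- The transformation `z ↦ z + α i` for `z ∈ I i`, extended by the identity outside the domain. -/
noncomputable def toFun (T : IET s) (z : ℝ) : ℝ := z + ∑ i, if z ∈ T.I i then T.α i else 0

/-- The interval exchange transformation that puts the semi-intervals back. -/
noncomputable def inv (T : IET s) : IET s where
  left := T.left
  len k := T.len (T.perm.symm k)
  len_pos _ := T.len_pos _
  perm := T.perm.symm

theorem γ_add_le (T : IET s) {i j : Fin s} (h : i < j) : T.γ i + T.len i ≤ T.γ j := by
  have : ∑ k with k < i, T.len k + T.len i ≤ ∑ k with k < j, T.len k := by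
    rw [add_comm, ← Finset.sum_insert (by simp)]
    apply Finset.sum_le_sum_of_subset_of_nonneg
    · intro k hk
      simp only [Finset.mem_insert, Finset.mem_filter, Finset.mem_univ, true_and] at hk ⊢
      rcases hk with rfl | hk
      · exact h
      · exact hk.trans h
    · intro k _ _
      exact (T.len_pos k).le
  unfold γ
  linarith

theorem eq_of_mem_I (T : IET s) {i j : Fin s} {z : ℝ} (hi : z ∈ T.I i) (hj : z ∈ T.I j) :
    i = j := by
  rcases lt_trichotomy i j with h | h | h
  · have := T.γ_add_le h
    exact absurd hi.2 (not_lt.2 (this.trans hj.1))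
  · exact h
  · have := T.γ_add_le h
    exact absurd hj.2 (not_lt.2 (this.trans hi.1))

theorem I_subset (T : IET s) (i : Fin s) : T.I i ⊆ T.dom := by
  intro z hz
  have h0 : 0 ≤ ∑ k with k < i, T.len k := Finset.sum_nonneg fun k _ => (T.len_pos k).le
  have h1 : ∑ k with k < i, T.len k + T.len i ≤ ∑ k, T.len k := by
    rw [add_comm, ← Finset.sum_insert (by simp)]
    exact Finset.sum_le_sum_of_subset_of_nonneg (Finset.subset_univ _)
      fun k _ _ => (T.len_pos k).le
  have h2 := hz.1
  have h3 := hz.2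
  unfold γ at h2 h3
  unfold dom right
  constructor <;> linarith

theorem exists_mem_I (T : IET s) {z : ℝ} (hz : z ∈ T.dom) : ∃ i, z ∈ T.I i := by
  classical
  let G : ℕ → ℝ := fun k => T.left + ∑ j with (j : Fin s).val < k, T.len j
  have hG : ∃ k, z < G k := by
    refine ⟨s, ?_⟩
    have : G s = T.right := by simp [G, right]
    rw [this]
    exact hz.2
  have hG0 : G 0 = T.left := by simp [G]
  obtain ⟨k, hk⟩ : ∃ k, Nat.find hG = k + 1 := by
    refine Nat.exists_eq_succ_of_ne_zero fun h => ?_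
    have := Nat.find_spec hG
    rw [h, hG0] at this
    exact absurd hz.1 (not_le.2 this)
  have h1 : z < G (k + 1) := hk ▸ Nat.find_spec hG
  have h2 : G k ≤ z := not_lt.1 (Nat.find_min hG (by omega))
  by_cases hks : k < s
  · have h3 : G (k + 1) = G k + T.len ⟨k, hks⟩ := by
      have : (Finset.univ.filter fun j : Fin s => j.val < k + 1)
          = insert ⟨k, hks⟩ (Finset.univ.filter fun j : Fin s => j.val < k) := by
        ext j
        simp only [Finset.mem_insert, Finset.mem_filter, Finset.mem_univ, true_and, Fin.ext_iff]
        omega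
      simp only [G]
      rw [this, Finset.sum_insert (by simp)]
      ring
    exact ⟨⟨k, hks⟩, h2, by rw [h3] at h1; exact h1⟩
  · exfalso
    have : G k = G (k + 1) := by
      simp only [G]
      congr 2
      ext j
      simp only [Finset.mem_filter, Finset.mem_univ, true_and]
      omega
    linarith

theorem toFun_of_mem (T : IET s) {i : Fin s} {z : ℝ} (hz : z ∈ T.I i) : T.toFun z = z + T.α i := by
  classical
  unfold toFun
  rw [Finset.sum_eq_single i]
  · rw [if_pos hz]
  · intro j _ hj
    rw [if_neg fun h => hj (T.eq_of_mem_I h hz)]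
  · simp

theorem toFun_of_notMem (T : IET s) {z : ℝ} (hz : z ∉ T.dom) : T.toFun z = z := by
  classical
  unfold toFun
  rw [Finset.sum_eq_zero, add_zero]
  intro j _
  rw [if_neg fun h => hz (T.I_subset j h)]

theorem inv_dom (T : IET s) : T.inv.dom = T.dom := by
  have : ∑ i, T.len (T.perm.symm i) = ∑ i, T.len i := Equiv.sum_comp T.perm.symm T.len
  simp only [dom, right, inv, this]

theorem inv_γ (T : IET s) (i : Fin s) : T.inv.γ (T.perm i) = T.δ i := by
  simp only [γ, δ, inv, Finset.sum_filter]
  rw [← Equiv.sum_comp T.perm]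
  simp

theorem inv_δ (T : IET s) (i : Fin s) : T.inv.δ (T.perm i) = T.γ i := by
  have h : T.inv.δ (T.perm i) = T.left + ∑ k with T.perm.symm k < T.perm.symm (T.perm i),
      T.len (T.perm.symm k) := rfl
  rw [h, γ, Finset.sum_filter, Finset.sum_filter, Equiv.symm_apply_apply]
  congr 1
  exact Equiv.sum_comp T.perm.symm fun j => if j < i then T.len j else 0

theorem toFun_mem_inv_I (T : IET s) {i : Fin s} {z : ℝ} (hz : z ∈ T.I i) :
    T.toFun z ∈ T.inv.I (T.perm i) := by
  have h : T.inv.len (T.perm i) = T.len i := by simp [inv]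
  have h1 := hz.1
  have h2 := hz.2
  unfold I
  rw [T.toFun_of_mem hz, T.inv_γ, h, α]
  constructor <;> linarith

theorem inv_toFun_toFun (T : IET s) (z : ℝ) : T.inv.toFun (T.toFun z) = z := by
  by_cases hz : z ∈ T.dom
  · obtain ⟨i, hi⟩ := T.exists_mem_I hz
    rw [T.inv.toFun_of_mem (T.toFun_mem_inv_I hi), T.toFun_of_mem hi]
    simp only [α, T.inv_γ, T.inv_δ]
    ring
  · rw [T.toFun_of_notMem hz, T.inv.toFun_of_notMem (by rwa [T.inv_dom])]

theorem inv_inv (T : IET s) : T.inv.inv = T := by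
  cases T
  simp [inv]

/-- The transformation as a bijection, so that all its integer powers make sense. -/
noncomputable def map (T : IET s) : Equiv.Perm ℝ where
  toFun := T.toFun
  invFun := T.inv.toFun
  left_inv := T.inv_toFun_toFun
  right_inv z := by
    have h := T.inv.inv_toFun_toFun z
    rwa [T.inv_inv] at h

/-- The orbit of a point. -/
def orbit (T : IET s) (z : ℝ) : Set ℝ := Set.range fun n : ℤ => (T.map ^ n) z

/-- Minimality: every orbit is dense in the domain. -/
def IsMinimal (T : IET s) : Prop := ∀ z ∈ T.dom, T.dom ⊆ closure (T.orbit z)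

/-- The set of separation points. -/
def sep (T : IET s) : Set ℝ := Set.range T.γ

/-- The union of the sets `T ^ i (Sep T)` for `-m + 1 ≤ i ≤ n`. -/
def D (T : IET s) (m n : ℕ) : Set ℝ := ⋃ i ∈ Set.Icc (-(m : ℤ) + 1) (n : ℤ), (T.map ^ i) '' T.sep

/-- The semi-intervals into which the points of `D m n` cut the domain. -/
def Umn (T : IET s) (m n : ℕ) : Set (Set ℝ) :=
  {J | ∃ t w : ℝ, t < w ∧ t ∈ T.D m n ∪ {T.left, T.right} ∧ w ∈ T.D m n ∪ {T.left, T.right} ∧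
    Disjoint (Set.Ioo t w) (T.D m n) ∧ J = Set.Ico t w}

/-- The union of the families `Umn m n` over all `m, n ≥ 0`. -/
def U (T : IET s) : Set (Set ℝ) := ⋃ (m : ℕ) (n : ℕ), T.Umn m n

end IET

/-- The embedding `m + n √d ↦ m + n √d` of `ℤ[√d]` in the reals. -/
noncomputable def sqrtdEmb (d : ℕ) : ℤ√(d : ℤ) →+* ℝ := Zsqrtd.toReal (Int.natCast_nonneg d)

open Classical in
/-- The complexity `max (|m|, |n|)` of the real number `m + n √d`. It is used only for elements of
`ℤ[√d]`; the value at all other reals is `0`. -/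
noncomputable def Psi (d : ℕ) (x : ℝ) : ℝ :=
  if h : ∃ z : ℤ√(d : ℤ), sqrtdEmb d z = x then max |(h.choose.re : ℝ)| |(h.choose.im : ℝ)| else 0

/-- For square-free `d ≥ 2` the coordinates are unique, so `Psi` does not depend on a choice. -/
theorem Psi_eq {d : ℕ} (hd : 2 ≤ d) (hsq : Squarefree d) (m n : ℤ) :
    Psi d (m + n * √(d : ℝ)) = max |(m : ℝ)| |(n : ℝ)| := by
  have hinj : Function.Injective (sqrtdEmb d) := by
    refine Zsqrtd.toReal_injective _ fun k hk => ?_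
    have h1 : d = k.natAbs * k.natAbs := by
      have := congrArg Int.natAbs hk
      rwa [Int.natAbs_natCast, Int.natAbs_mul] at this
    have h2 : IsUnit k.natAbs := hsq _ ⟨1, by rw [mul_one]; exact h1⟩
    rw [Nat.isUnit_iff.1 h2] at h1
    omega
  have hz : sqrtdEmb d ⟨m, n⟩ = m + n * √(d : ℝ) := by
    simp [sqrtdEmb, Zsqrtd.toReal]
  have h : ∃ z : ℤ√(d : ℤ), sqrtdEmb d z = m + n * √(d : ℝ) := ⟨_, hz⟩
  have hc : h.choose = ⟨m, n⟩ := hinj (h.choose_spec.trans hz.symm)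
  rw [Psi, dif_pos h, hc]

namespace IET

/-- `T` is defined over `ℤ[√d]`: the left end point of the domain and all the lengths (hence also
all the separation points and all the translation values) lie in `ℤ[√d]`. -/
def DefinedOver {s : ℕ} (T : IET s) (d : ℕ) : Prop :=
  T.left ∈ Set.range (sqrtdEmb d) ∧ ∀ i, T.len i ∈ Set.range (sqrtdEmb d)

/-- The algebra of subsets of the domain that are finite unions of semi-intervals with end points
in `ℤ[√d]`. -/
def algebra {s : ℕ} (T : IET s) (d : ℕ) : Set (Set ℝ) :=
  {S | S ⊆ T.dom ∧ ∃ F : Finset (ℝ × ℝ),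
    (∀ p ∈ F, p.1 < p.2 ∧ p.1 ∈ Set.range (sqrtdEmb d) ∧ p.2 ∈ Set.range (sqrtdEmb d)) ∧
    S = ⋃ p ∈ F, Set.Ico p.1 p.2}

end IET

/-- The complexity of a set: the maximum of the complexities of its boundary points. -/
noncomputable def PsiSet (d : ℕ) (S : Set ℝ) : ℝ := sSup (Psi d '' frontier S)

/-- The reduced complexity of a set. -/
noncomputable def PiSet (d : ℕ) (S : Set ℝ) : ℝ := MeasureTheory.volume.real S * PsiSet d S

/-!
Both bounds rest on the fact that a nonzero element `z` of `ℤ[√d]` satisfies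
`|z| ≥ 1 / ((1 + √d) Ψ(z))`, because its norm is a nonzero integer (`one_le_abs_mul_Psi`). Applied
to the length `w - t` of `J = [t, w[`, it gives the lower bound at once.

For the upper bound let `J` belong to `U_{m,n}(T)`. The end points of `J` are reached from finitely
many points by at most `m + n + 1` translations, so `Ψ(J) = O(m + n + 1)`
(`IET.DefinedOver.endpoint`), and it remains to show `|J| = O(1 / (m + n + 1))`. As the interior of
`J` avoids `D_{m,n}(T)`, the powers `T ^ i` with `-n ≤ i ≤ m` are translations on `J`; in other
words, the first `M = m + n` powers of `T` translate the semi-interval `K = T ^ (-n) J`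
(`IET.exists_translatesUpTo_of_disjoint`).

Let `ε = |K|`. If `M` is large compared to `1 / ε`, two of the first `O(1 / ε)` images of `K`
overlap, so some `T ^ k` with `k = O(1 / ε)` translates `K` by an amount `β` with `|β| < ε`. A
minimal `T` has no periodic points, so `β ≠ 0`; moreover `Ψ(β) = O(k)`, and hence `|β|` is bounded
below by a constant multiple of `ε`. Therefore a bounded number `q` of consecutive translates
`K, K + β, …, K + q β` forms a semi-interval of length at least `2 ε`, and it is translated by the
first `M - q k = M - O(1 / ε)` powers of `T`. Repeating this doubling until the length exceeds that
of the domain gives `M = O(1 / ε + 1 / (2 ε) + 1 / (4 ε) + ⋯) = O(1 / ε)`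
(`TranslatesUpTo.mul_length_le`).
-/

/-! ### Complexity of elements of `ℤ[√d]` -/

section Complexity

variable {d : ℕ}

theorem mem_range_sqrtdEmb {x : ℝ} :
    x ∈ Set.range (sqrtdEmb d) ↔ ∃ m n : ℤ, x = m + n * √(d : ℝ) := by
  constructor
  · rintro ⟨z, rfl⟩
    exact ⟨z.re, z.im, by simp [sqrtdEmb, Zsqrtd.toReal]⟩
  · rintro ⟨m, n, rfl⟩
    exact ⟨⟨m, n⟩, by simp [sqrtdEmb, Zsqrtd.toReal]⟩

theorem Psi_nonneg (x : ℝ) : 0 ≤ Psi d x := by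
  unfold Psi
  split_ifs
  · exact le_max_of_le_left (abs_nonneg _)
  · exact le_rfl

theorem add_mem_range_sqrtdEmb {x y : ℝ} (hx : x ∈ Set.range (sqrtdEmb d))
    (hy : y ∈ Set.range (sqrtdEmb d)) : x + y ∈ Set.range (sqrtdEmb d) :=
  (sqrtdEmb d).range.add_mem hx hy

theorem sub_mem_range_sqrtdEmb {x y : ℝ} (hx : x ∈ Set.range (sqrtdEmb d))
    (hy : y ∈ Set.range (sqrtdEmb d)) : x - y ∈ Set.range (sqrtdEmb d) :=
  (sqrtdEmb d).range.sub_mem hx hy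

theorem PiSet_Ico {t w : ℝ} (h : t < w) :
    PiSet d (Set.Ico t w) = (w - t) * max (Psi d t) (Psi d w) := by
  rw [PiSet, PsiSet, frontier_Ico h, Set.image_pair, csSup_pair, Real.volume_real_Ico_of_le h.le]

variable (hd : 2 ≤ d) (hsq : Squarefree d)

include hd hsq

theorem Psi_add_le {x y : ℝ} (hx : x ∈ Set.range (sqrtdEmb d))
    (hy : y ∈ Set.range (sqrtdEmb d)) : Psi d (x + y) ≤ Psi d x + Psi d y := by
  obtain ⟨m, n, rfl⟩ := mem_range_sqrtdEmb.1 hx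
  obtain ⟨p, q, rfl⟩ := mem_range_sqrtdEmb.1 hy
  have h : (m + n * √(d : ℝ) + (p + q * √(d : ℝ)) : ℝ)
      = ((m + p : ℤ) : ℝ) + ((n + q : ℤ) : ℝ) * √(d : ℝ) := by push_cast; ring
  rw [h, Psi_eq hd hsq, Psi_eq hd hsq, Psi_eq hd hsq]
  push_cast
  exact max_le ((abs_add_le _ _).trans (add_le_add (le_max_left _ _) (le_max_left _ _)))
    ((abs_add_le _ _).trans (add_le_add (le_max_right _ _) (le_max_right _ _)))

theorem Psi_neg {x : ℝ} (hx : x ∈ Set.range (sqrtdEmb d)) : Psi d (-x) = Psi d x := by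
  obtain ⟨m, n, rfl⟩ := mem_range_sqrtdEmb.1 hx
  have h : (-(m + n * √(d : ℝ)) : ℝ) = ((-m : ℤ) : ℝ) + ((-n : ℤ) : ℝ) * √(d : ℝ) := by
    push_cast; ring
  rw [h, Psi_eq hd hsq, Psi_eq hd hsq]
  push_cast
  rw [abs_neg, abs_neg]

theorem Psi_sub_le {x y : ℝ} (hx : x ∈ Set.range (sqrtdEmb d))
    (hy : y ∈ Set.range (sqrtdEmb d)) : Psi d (x - y) ≤ Psi d x + Psi d y := by
  rw [sub_eq_add_neg, ← Psi_neg hd hsq hy]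
  exact Psi_add_le hd hsq hx ((sqrtdEmb d).range.neg_mem hy)

/-- A nonzero element of `ℤ[√d]` has a norm of absolute value at least `1`, and its conjugate is
bounded by its complexity. -/
theorem one_le_abs_mul_Psi {x : ℝ} (hx : x ∈ Set.range (sqrtdEmb d)) (h0 : x ≠ 0) :
    1 ≤ (1 + √(d : ℝ)) * (|x| * Psi d x) := by
  obtain ⟨m, n, rfl⟩ := mem_range_sqrtdEmb.1 hx
  rw [Psi_eq hd hsq]
  set P : ℝ := max |(m : ℝ)| |(n : ℝ)|
  have hs : √(d : ℝ) * √(d : ℝ) = d := Real.mul_self_sqrt (Nat.cast_nonneg d)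
  have hnorm : (m + n * √(d : ℝ)) * (m - n * √(d : ℝ)) = ((m * m - d * (n * n) : ℤ) : ℝ) := by
    push_cast
    linear_combination (-(n : ℝ) * n) * hs
  have hconj0 : (m : ℝ) - n * √(d : ℝ) ≠ 0 := by
    intro h
    -- the conjugate has the same complexity, so it vanishes only together with `x`
    have h1 : Psi d (m - n * √(d : ℝ)) = Psi d (m + n * √(d : ℝ)) := by
      have h2 := Psi_eq hd hsq m (-n)
      push_cast at h2
      rw [neg_mul, ← sub_eq_add_neg, abs_neg] at h2
      rw [h2, Psi_eq hd hsq]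
    have h3 := Psi_eq hd hsq 0 0
    simp only [Int.cast_zero, zero_mul, add_zero, abs_zero, max_self] at h3
    rw [h, h3, Psi_eq hd hsq] at h1
    have hm : (m : ℝ) = 0 := abs_eq_zero.1 (le_antisymm (h1 ▸ le_max_left _ _) (abs_nonneg _))
    have hn : (n : ℝ) = 0 := abs_eq_zero.1 (le_antisymm (h1 ▸ le_max_right _ _) (abs_nonneg _))
    exact h0 (by rw [hm, hn]; ring)
  have hZ : (m * m - d * (n * n) : ℤ) ≠ 0 := by
    intro h
    rw [h, Int.cast_zero] at hnorm
    exact (mul_ne_zero h0 hconj0) hnorm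
  have h1 : (1 : ℝ) ≤ |m + n * √(d : ℝ)| * |m - n * √(d : ℝ)| := by
    rw [← abs_mul, hnorm, ← Int.cast_abs]
    exact_mod_cast Int.one_le_abs hZ
  have h2 : |m - n * √(d : ℝ)| ≤ (1 + √(d : ℝ)) * P := by
    calc |m - n * √(d : ℝ)| ≤ |(m : ℝ)| + |n * √(d : ℝ)| := abs_sub _ _
      _ = |(m : ℝ)| + |(n : ℝ)| * √(d : ℝ) := by rw [abs_mul, abs_of_nonneg (Real.sqrt_nonneg _)]
      _ ≤ P + P * √(d : ℝ) :=
        add_le_add (le_max_left _ _)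
          (mul_le_mul_of_nonneg_right (le_max_right _ _) (Real.sqrt_nonneg _))
      _ = (1 + √(d : ℝ)) * P := by ring
  calc (1 : ℝ) ≤ |m + n * √(d : ℝ)| * |m - n * √(d : ℝ)| := h1
    _ ≤ |m + n * √(d : ℝ)| * ((1 + √(d : ℝ)) * P) :=
      mul_le_mul_of_nonneg_left h2 (abs_nonneg _)
    _ = _ := by ring

end Complexity

/-! ### Powers acting as translations on a semi-interval -/

/-- The powers `f ^ i` with `0 ≤ i ≤ M` all act on `S` as translations. -/
def TranslatesUpTo (f : Equiv.Perm ℝ) (M : ℕ) (S : Set ℝ) : Prop :=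
  ∀ i ≤ M, ∃ c : ℝ, ∀ x ∈ S, (f ^ i) x = x + c

namespace TranslatesUpTo

variable {f : Equiv.Perm ℝ}

theorem mem_or_sub_mem_of_mem_union {a ε β x : ℝ} (hβ : |β| < ε)
    (hx : x ∈ Set.Ico (min a (a + β)) (min a (a + β) + (ε + |β|))) :
    x ∈ Set.Ico a (a + ε) ∨ x - β ∈ Set.Ico a (a + ε) := by
  obtain ⟨h1, h2⟩ := hx
  rcases le_total 0 β with h | h
  · rw [abs_of_nonneg h] at h2 hβ
    rw [min_eq_left (by linarith)] at h1 h2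
    by_cases hc : x < a + ε
    · exact Or.inl ⟨h1, hc⟩
    · exact Or.inr ⟨by linarith, by linarith⟩
  · rw [abs_of_nonpos h] at h2 hβ
    rw [min_eq_right (by linarith)] at h1 h2
    by_cases hc : a ≤ x
    · exact Or.inl ⟨hc, by linarith⟩
    · exact Or.inr ⟨by linarith, by linarith⟩

/-- If `f ^ k` moves the semi-interval `K` by less than its length, then `K` and its translate
`f ^ k K` overlap, so the powers that translate both translate their union by the same amount. -/
theorem extend {M k : ℕ} {a ε β : ℝ} (h : TranslatesUpTo f M (Set.Ico a (a + ε))) (hk : k ≤ M)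
    (hfk : ∀ x ∈ Set.Ico a (a + ε), (f ^ k) x = x + β) (hβ : |β| < ε) :
    TranslatesUpTo f (M - k) (Set.Ico (min a (a + β)) (min a (a + β) + (ε + |β|))) := by
  intro i hi
  obtain ⟨c, hc⟩ := h i (by omega)
  obtain ⟨c', hc'⟩ := h (i + k) (by omega)
  have hpow : ∀ y ∈ Set.Ico a (a + ε), (f ^ i) (y + β) = y + c' := fun y hy => by
    rw [← hfk y hy, ← Equiv.Perm.mul_apply, ← pow_add, hc' y hy]
  have hcc : c' = β + c := by
    -- a point `u` of the overlap, up to the translation by `β`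
    obtain ⟨u, hu, hu'⟩ : ∃ u ∈ Set.Ico a (a + ε), u + β ∈ Set.Ico a (a + ε) := by
      rcases le_total 0 β with h | h
      · rw [abs_of_nonneg h] at hβ
        exact ⟨a, ⟨le_rfl, by linarith⟩, by linarith, by linarith⟩
      · rw [abs_of_nonpos h] at hβ
        exact ⟨a - β, ⟨by linarith, by linarith⟩, by linarith, by linarith⟩
    have h1 := hpow u hu
    rw [hc _ hu'] at h1
    linarith
  refine ⟨c, fun x hx => ?_⟩
  rcases mem_or_sub_mem_of_mem_union hβ hx with hx | hx
  · exact hc x hx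
  · have h1 := hpow _ hx
    rw [sub_add_cancel] at h1
    rw [h1, hcc]
    ring

variable {l r : ℝ}

theorem extend_iterate (hmaps : ∀ (i : ℕ), ∀ x ∈ Set.Ico l r, (f ^ i) x ∈ Set.Ico l r)
    {M k : ℕ} {a ε β : ℝ} (hsub : Set.Ico a (a + ε) ⊆ Set.Ico l r)
    (h : TranslatesUpTo f M (Set.Ico a (a + ε)))
    (hfk : ∀ x ∈ Set.Ico a (a + ε), (f ^ k) x = x + β) (hβ : |β| < ε) (q : ℕ) (hq : q * k ≤ M) :
    ∃ a', Set.Ico a (a + ε) ⊆ Set.Ico a' (a' + (ε + q * |β|)) ∧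
      Set.Ico a' (a' + (ε + q * |β|)) ⊆ Set.Ico l r ∧
      TranslatesUpTo f (M - q * k) (Set.Ico a' (a' + (ε + q * |β|))) := by
  induction q with
  | zero => exact ⟨a, by simp, by simpa using hsub, by simpa using h⟩
  | succ q ih =>
    rw [add_mul, one_mul] at hq
    obtain ⟨a', h1, h2, h3⟩ := ih (by omega)
    set ε' := ε + q * |β| with hε'
    have hβ0 := abs_nonneg β
    have hε'1 : ε ≤ ε' := by
      have : 0 ≤ (q : ℝ) * |β| := by positivity
      linarith
    have haK : a ∈ Set.Ico a (a + ε) := ⟨le_rfl, by linarith⟩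
    have hfk' : ∀ x ∈ Set.Ico a' (a' + ε'), (f ^ k) x = x + β := by
      obtain ⟨c, hc⟩ := h3 k (by omega)
      have h4 := hc a (h1 haK)
      rw [hfk a haK] at h4
      have : c = β := by linarith
      rwa [this] at hc
    have hβ' : |β| < ε' := by linarith
    have hlen : ε + ((q + 1 : ℕ) : ℝ) * |β| = ε' + |β| := by rw [hε']; push_cast; ring
    rw [hlen]
    refine ⟨min a' (a' + β), fun x hx => ?_, fun x hx => ?_, ?_⟩
    · obtain ⟨hx1, hx2⟩ := h1 hx
      refine ⟨(min_le_left _ _).trans hx1, hx2.trans_le ?_⟩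
      rcases min_cases a' (a' + β) with ⟨hm, -⟩ | ⟨hm, -⟩ <;> rw [hm]
      · linarith
      · linarith [neg_abs_le β]
    · rcases mem_or_sub_mem_of_mem_union hβ' hx with hx | hx
      · exact h2 hx
      · have := hmaps k _ (h2 hx)
        rwa [hfk' _ hx, sub_add_cancel] at this
    · have := h3.extend (by omega) hfk' hβ'
      rwa [Nat.sub_sub, ← Nat.succ_mul] at this

/-- Pigeonhole: among sufficiently many translates of `K` inside a bounded semi-interval two
overlap, so some power moves `K` by less than its length. -/
theorem exists_overlap (hmaps : ∀ (i : ℕ), ∀ x ∈ Set.Ico l r, (f ^ i) x ∈ Set.Ico l r)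
    {M : ℕ} {a ε : ℝ} (hε : 0 < ε) (hsub : Set.Ico a (a + ε) ⊆ Set.Ico l r)
    (h : TranslatesUpTo f M (Set.Ico a (a + ε))) (hM : ⌊(r - l) / ε⌋₊ + 1 ≤ M) :
    ∃ k, 0 < k ∧ k ≤ ⌊(r - l) / ε⌋₊ + 1 ∧ ∃ β, |β| < ε ∧
      ∀ x ∈ Set.Ico a (a + ε), (f ^ k) x = x + β := by
  set N := ⌊(r - l) / ε⌋₊ with hN
  have haK : a ∈ Set.Ico a (a + ε) := ⟨le_rfl, by linarith⟩
  have hmem : ∀ i : ℕ, (f ^ i) a ∈ Set.Ico l r := fun i => hmaps i a (hsub haK)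
  obtain ⟨i, hi, j, hj, hij, hfl⟩ :
      ∃ i ∈ Finset.range (N + 2), ∃ j ∈ Finset.range (N + 2), i ≠ j ∧
        ⌊((f ^ i) a - l) / ε⌋₊ = ⌊((f ^ j) a - l) / ε⌋₊ := by
    refine Finset.exists_ne_map_eq_of_card_lt_of_maps_to (t := Finset.range (N + 1))
      (by simp) fun i _ => ?_
    simp only [Finset.coe_range, Set.mem_Iio, Nat.lt_succ_iff]
    refine Nat.floor_le_floor (div_le_div_of_nonneg_right ?_ hε.le)
    linarith [(hmem i).2]
  wlog hlt : i < j generalizing i j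
  · exact this j hj i hi hij.symm hfl.symm (by omega)
  rw [Finset.mem_range] at hi hj
  have hclose : |(f ^ i) a - (f ^ j) a| < ε := by
    have hi0 : 0 ≤ ((f ^ i) a - l) / ε := div_nonneg (by linarith [(hmem i).1]) hε.le
    have hj0 : 0 ≤ ((f ^ j) a - l) / ε := div_nonneg (by linarith [(hmem j).1]) hε.le
    have h1 := Nat.floor_le hi0
    have h2 := Nat.lt_floor_add_one (((f ^ i) a - l) / ε)
    have h3 := Nat.floor_le hj0
    have h4 := Nat.lt_floor_add_one (((f ^ j) a - l) / ε)
    rw [hfl] at h1 h2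
    have h5 : |((f ^ i) a - l) / ε - ((f ^ j) a - l) / ε| < 1 := by
      rw [abs_lt]; constructor <;> linarith
    rwa [← sub_div, sub_sub_sub_cancel_right, abs_div, abs_of_pos hε, div_lt_one hε] at h5
  obtain ⟨ci, hci⟩ := h i (by omega)
  obtain ⟨cj, hcj⟩ := h j (by omega)
  obtain ⟨β, hβ⟩ := h (j - i) (by omega)
  rw [hci a haK, hcj a haK, add_sub_add_left_eq_sub, abs_lt] at hclose
  -- `u` and `v` are points of `K` with `f ^ i u = f ^ j v`
  obtain ⟨u, hu, v, hv, huv⟩ : ∃ u ∈ Set.Ico a (a + ε), ∃ v ∈ Set.Ico a (a + ε),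
      u + ci = v + cj := by
    rcases le_total ci cj with hc | hc
    · exact ⟨a + (cj - ci), ⟨by linarith, by linarith⟩, a, haK, by ring⟩
    · exact ⟨a, haK, a + (ci - cj), ⟨by linarith, by linarith⟩, by ring⟩
  have huβ : u = v + β := by
    apply (f ^ i).injective
    rw [← hβ v hv, ← Equiv.Perm.mul_apply, ← pow_add, Nat.add_sub_cancel' hlt.le, hci u hu,
      hcj v hv, huv]
  refine ⟨j - i, by omega, by omega, β, ?_, hβ⟩
  rw [abs_lt]
  constructor <;> linarith [hu.1, hu.2, hv.1, hv.2]

/-- Assume that `f ^ k` moves no point of `[l, r[` by less than `1 / (κ k)`. If the first `M`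
powers of `f` translate a semi-interval of length `ε`, then `M` is `O(1 / ε)`. Indeed, after
`O(1 / ε)` steps the semi-interval comes back shifted by an amount comparable to `ε`; a bounded
number of such returns yields a semi-interval of length at least `2 ε` that is still translated by
all but `O(1 / ε)` of the powers, and iterating the doubling gives a geometric sum. -/
theorem mul_length_le (hmaps : ∀ (i : ℕ), ∀ x ∈ Set.Ico l r, (f ^ i) x ∈ Set.Ico l r)
    {κ : ℝ} (hκ : 0 ≤ κ) (hgap : ∀ k : ℕ, 0 < k → ∀ x ∈ Set.Ico l r, 1 ≤ κ * k * |(f ^ k) x - x|)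
    {q : ℕ} (hq : 2 * (r - l) * κ ≤ q) {M : ℕ} {a ε : ℝ} (hε : 0 < ε)
    (hsub : Set.Ico a (a + ε) ⊆ Set.Ico l r) (h : TranslatesUpTo f M (Set.Ico a (a + ε))) :
    M * ε ≤ 4 * q * (r - l) := by
  obtain ⟨N, hN⟩ : ∃ N : ℕ, r - l < 2 ^ N * ε := by
    obtain ⟨N, hN⟩ := pow_unbounded_of_one_lt ((r - l) / ε) (one_lt_two)
    exact ⟨N, (div_lt_iff₀ hε).1 hN⟩
  induction N generalizing M a ε with
  | zero =>
    obtain ⟨h1, h2⟩ := (Set.Ico_subset_Ico_iff (by linarith)).1 hsub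
    simp only [pow_zero, one_mul] at hN
    linarith
  | succ N ih =>
    obtain ⟨h1, h2⟩ := (Set.Ico_subset_Ico_iff (by linarith)).1 hsub
    set k₀ := ⌊(r - l) / ε⌋₊ + 1 with hk₀
    have hk₀ε : (k₀ : ℝ) * ε ≤ 2 * (r - l) := by
      have h3 : (⌊(r - l) / ε⌋₊ : ℝ) * ε ≤ r - l :=
        (le_div_iff₀ hε).1 (Nat.floor_le (div_nonneg (by linarith) hε.le))
      rw [hk₀]
      push_cast
      linarith
    have hqk : ∀ k ≤ k₀, ((q * k : ℕ) : ℝ) * ε ≤ 2 * q * (r - l) := fun k hk => by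
      have h3 : (k : ℝ) * ε ≤ k₀ * ε :=
        mul_le_mul_of_nonneg_right (by exact_mod_cast hk) hε.le
      have h4 := mul_le_mul_of_nonneg_left (h3.trans hk₀ε) (Nat.cast_nonneg (α := ℝ) q)
      push_cast
      linarith
    have hq0 : 0 ≤ (q : ℝ) * (r - l) := mul_nonneg (Nat.cast_nonneg _) (by linarith)
    rcases lt_or_ge M (q * k₀) with hM | hM
    · have h3 : (M : ℝ) * ε ≤ ((q * k₀ : ℕ) : ℝ) * ε :=
        mul_le_mul_of_nonneg_right (by exact_mod_cast hM.le) hε.le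
      linarith [hqk k₀ le_rfl]
    · have haK : a ∈ Set.Ico a (a + ε) := ⟨le_rfl, by linarith⟩
      have hq1 : 1 ≤ q := by
        -- `κ` is positive because `f` moves the point `a`
        have h3 := hgap 1 one_pos a (hsub haK)
        have hκ' : 0 < κ := by
          rcases hκ.eq_or_lt with h4 | h4
          · rw [← h4] at h3
            norm_num at h3
          · exact h4
        have h5 : (0 : ℝ) < q := lt_of_lt_of_le (mul_pos (by linarith) hκ') hq
        exact_mod_cast h5
      obtain ⟨k, hk, hkk, β, hβ, hfk⟩ := exists_overlap hmaps hε hsub h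
        ((Nat.le_mul_of_pos_left _ hq1).trans hM)
      have hqkM : q * k ≤ M := (Nat.mul_le_mul_left q hkk).trans hM
      obtain ⟨a', -, hsub', h'⟩ := h.extend_iterate hmaps hsub hfk hβ q hqkM
      have hβε : ε ≤ q * |β| := by
        have h3 := hgap k hk a (hsub haK)
        rw [hfk a haK, add_sub_cancel_left] at h3
        have h4 : (k : ℝ) * ε ≤ 2 * (r - l) :=
          (mul_le_mul_of_nonneg_right (by exact_mod_cast hkk) hε.le).trans hk₀ε
        calc ε = ε * 1 := (mul_one ε).symm
          _ ≤ ε * (κ * k * |β|) := mul_le_mul_of_nonneg_left h3 hε.le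
          _ = (k * ε) * (κ * |β|) := by ring
          _ ≤ (2 * (r - l)) * (κ * |β|) := mul_le_mul_of_nonneg_right h4 (by positivity)
          _ = (2 * (r - l) * κ) * |β| := by ring
          _ ≤ q * |β| := mul_le_mul_of_nonneg_right hq (abs_nonneg _)
      have h3 := ih (by linarith) hsub' h' (by
        rw [pow_succ] at hN
        have : (2 : ℝ) ^ N * (2 * ε) ≤ 2 ^ N * (ε + q * |β|) :=
          mul_le_mul_of_nonneg_left (by linarith) (by positivity)
        linarith)
      have h4 : ((M - q * k : ℕ) : ℝ) * (2 * ε) ≤ ((M - q * k : ℕ) : ℝ) * (ε + q * |β|) :=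
        mul_le_mul_of_nonneg_left (by linarith) (Nat.cast_nonneg _)
      have h5 := hqk k hkk
      rw [Nat.cast_sub hqkM] at h3 h4
      linarith

end TranslatesUpTo

/-! ### Powers of an interval exchange transformation -/

namespace IET

variable {s : ℕ} (T : IET s)

theorem map_inv : T.inv.map = T.map⁻¹ := by
  ext x
  rfl

theorem map_mem_dom {z : ℝ} (hz : z ∈ T.dom) : T.map z ∈ T.dom := by
  obtain ⟨i, hi⟩ := T.exists_mem_I hz
  have := T.inv.I_subset _ (T.toFun_mem_inv_I hi)
  rwa [T.inv_dom] at this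

theorem map_pow_mem_dom (n : ℕ) {z : ℝ} (hz : z ∈ T.dom) : (T.map ^ n) z ∈ T.dom := by
  induction n with
  | zero => simpa using hz
  | succ n ih =>
    rw [pow_succ', Equiv.Perm.mul_apply]
    exact T.map_mem_dom ih

theorem map_zpow_mem_dom (n : ℤ) {z : ℝ} (hz : z ∈ T.dom) : (T.map ^ n) z ∈ T.dom := by
  obtain ⟨n, rfl | rfl⟩ := n.eq_nat_or_neg
  · exact T.map_pow_mem_dom n hz
  · rw [← T.inv_dom] at hz
    have := T.inv.map_pow_mem_dom n hz
    rwa [T.inv_dom, T.map_inv, inv_pow, ← zpow_natCast, ← zpow_neg] at this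

theorem γ_mem_dom (i : Fin s) : T.γ i ∈ T.dom :=
  T.I_subset i ⟨le_rfl, by linarith [T.len_pos i]⟩

theorem D_subset_dom (m n : ℕ) : T.D m n ⊆ T.dom := by
  intro x hx
  simp only [D, Set.mem_iUnion] at hx
  obtain ⟨i, -, -, ⟨j, rfl⟩, rfl⟩ := hx
  exact T.map_zpow_mem_dom i (T.γ_mem_dom j)

/-- The separation points of the inverse transformation are the images of the separation points:
both are left end points of the images of the exchanged semi-intervals. -/
theorem exists_inv_γ_eq (j : Fin s) : ∃ i, T.inv.γ j = T.map (T.γ i) := by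
  refine ⟨T.perm.symm j, ?_⟩
  have h : T.map (T.γ (T.perm.symm j)) = T.γ (T.perm.symm j) + T.α (T.perm.symm j) :=
    T.toFun_of_mem ⟨le_rfl, by linarith [T.len_pos (T.perm.symm j)]⟩
  rw [h, α, add_sub_cancel, ← T.inv_γ, Equiv.apply_symm_apply]

/-- `T` translates a semi-interval that has no separation point in its interior. -/
theorem exists_map_eq_add {t w : ℝ} (hsub : Set.Ico t w ⊆ T.dom)
    (hsep : ∀ i, T.γ i ∉ Set.Ioo t w) : ∃ c, ∀ x ∈ Set.Ico t w, T.map x = x + c := by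
  rcases lt_or_ge t w with htw | htw
  · obtain ⟨i, hi⟩ := T.exists_mem_I (hsub ⟨le_rfl, htw⟩)
    refine ⟨T.α i, fun x hx => ?_⟩
    obtain ⟨j, hj⟩ := T.exists_mem_I (hsub hx)
    rcases lt_trichotomy i j with h | h | h
    · exact absurd ⟨hi.2.trans_le (T.γ_add_le h), hj.1.trans_lt hx.2⟩ (hsep j)
    · subst h
      exact T.toFun_of_mem hj
    · linarith [T.γ_add_le h, hi.1, hj.2, hx.1]
  · exact ⟨0, fun x hx => absurd (hx.1.trans_lt hx.2) (not_lt.2 htw)⟩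

theorem translatesUpTo_Ico {t w : ℝ} (hsub : Set.Ico t w ⊆ T.dom) {m : ℕ}
    (hsep : ∀ j < m, ∀ i, ∀ y ∈ Set.Ioo t w, (T.map ^ j) y ≠ T.γ i) :
    TranslatesUpTo T.map m (Set.Ico t w) := by
  intro n hn
  induction n with
  | zero => exact ⟨0, by simp⟩
  | succ n ih =>
    obtain ⟨c, hc⟩ := ih (by omega)
    obtain ⟨c', hc'⟩ := T.exists_map_eq_add (t := t + c) (w := w + c)
      (fun x hx => by
        have hx' : x - c ∈ Set.Ico t w := ⟨by linarith [hx.1], by linarith [hx.2]⟩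
        have := T.map_pow_mem_dom n (hsub hx')
        rwa [hc _ hx', sub_add_cancel] at this)
      (fun i hi => by
        have hi' : T.γ i - c ∈ Set.Ioo t w := ⟨by linarith [hi.1], by linarith [hi.2]⟩
        refine hsep n (by omega) i _ hi' ?_
        rw [hc _ (Set.Ioo_subset_Ico_self hi'), sub_add_cancel])
    refine ⟨c + c', fun x hx => ?_⟩
    rw [pow_succ', Equiv.Perm.mul_apply, hc x hx,
      hc' _ ⟨by linarith [hx.1], by linarith [hx.2]⟩, add_assoc]

/-- A semi-interval whose interior avoids `D m n` has a translate, namely its image under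
`T ^ (-n)`, that is translated by the first `m + n` powers of `T`. -/
theorem exists_translatesUpTo_of_disjoint {t w : ℝ} (hsub : Set.Ico t w ⊆ T.dom) {m n : ℕ}
    (hD : Disjoint (Set.Ioo t w) (T.D m n)) :
    ∃ a, Set.Ico a (a + (w - t)) ⊆ T.dom ∧
      TranslatesUpTo T.map (m + n) (Set.Ico a (a + (w - t))) := by
  have hmem : ∀ (e : ℤ) (i : Fin s), -(m : ℤ) + 1 ≤ e → e ≤ n →
      (T.map ^ e) (T.γ i) ∈ T.D m n := fun e i h1 h2 => by
    simp only [D, Set.mem_iUnion]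
    exact ⟨e, ⟨h1, h2⟩, _, ⟨i, rfl⟩, rfl⟩
  have hfwd : TranslatesUpTo T.map m (Set.Ico t w) := by
    refine T.translatesUpTo_Ico hsub fun j hj i y hy h => ?_
    refine Set.disjoint_left.1 hD hy ?_
    have h1 : y = (T.map ^ (-(j : ℤ))) (T.γ i) := by
      rw [← h, ← zpow_natCast, ← Equiv.Perm.mul_apply, ← zpow_add]
      simp
    rw [h1]
    exact hmem _ i (by omega) (by omega)
  have hbwd : TranslatesUpTo T.inv.map n (Set.Ico t w) := by
    refine T.inv.translatesUpTo_Ico (by rwa [T.inv_dom]) fun j hj i y hy h => ?_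
    refine Set.disjoint_left.1 hD hy ?_
    obtain ⟨i', hi'⟩ := T.exists_inv_γ_eq i
    have h1 : y = (T.map ^ ((j : ℤ) + 1)) (T.γ i') := by
      rw [zpow_add, zpow_one, Equiv.Perm.mul_apply, ← hi', ← h, T.map_inv, zpow_natCast,
        ← Equiv.Perm.mul_apply, inv_pow, mul_inv_cancel, Equiv.Perm.one_apply]
    rw [h1]
    exact hmem _ i' (by omega) (by omega)
  obtain ⟨c, hc⟩ := hbwd n le_rfl
  have hback : ∀ x ∈ Set.Ico (t + c) (t + c + (w - t)),
      x - c ∈ Set.Ico t w ∧ x = (T.map ^ (-(n : ℤ))) (x - c) := fun x hx => by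
    have hx' : x - c ∈ Set.Ico t w := ⟨by linarith [hx.1], by linarith [hx.2]⟩
    have h1 := hc _ hx'
    rw [sub_add_cancel, T.map_inv, inv_pow, ← zpow_natCast, ← zpow_neg] at h1
    exact ⟨hx', h1.symm⟩
  refine ⟨t + c, fun x hx => ?_, fun i hi => ?_⟩
  · obtain ⟨h1, h2⟩ := hback x hx
    rw [h2]
    exact T.map_zpow_mem_dom _ (hsub h1)
  · have hpow : ∀ x ∈ Set.Ico (t + c) (t + c + (w - t)),
        (T.map ^ i) x = (T.map ^ ((i : ℤ) - n)) (x - c) := fun x hx => by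
      conv_lhs => rw [(hback x hx).2]
      rw [← zpow_natCast, ← Equiv.Perm.mul_apply, ← zpow_add, ← sub_eq_add_neg]
    rcases le_total n i with hni | hni
    · obtain ⟨c', hc'⟩ := hfwd (i - n) (by omega)
      refine ⟨c' - c, fun x hx => ?_⟩
      rw [hpow x hx, ← Nat.cast_sub hni, zpow_natCast, hc' _ (hback x hx).1]
      ring
    · obtain ⟨c', hc'⟩ := hbwd (n - i) (by omega)
      refine ⟨c' - c, fun x hx => ?_⟩
      have h1 := hc' _ (hback x hx).1
      rw [T.map_inv, inv_pow, ← zpow_natCast, ← zpow_neg, Nat.cast_sub hni, neg_sub] at h1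
      rw [hpow x hx, h1]
      ring

/-- A minimal interval exchange transformation has no periodic point, since a finite orbit is
closed and cannot contain a semi-interval. -/
theorem IsMinimal.pow_apply_ne {T : IET s} (hmin : T.IsMinimal) {k : ℕ} (hk : 0 < k) {x : ℝ}
    (hx : x ∈ T.dom) : (T.map ^ k) x ≠ x := by
  intro h
  have hk0 : (0 : ℤ) < k := by exact_mod_cast hk
  have hfin : (T.orbit x).Finite := by
    refine ((Set.finite_Ico (0 : ℤ) k).image fun n => (T.map ^ n) x).subset ?_
    rintro _ ⟨n, rfl⟩
    refine ⟨n % k, ⟨Int.emod_nonneg _ hk0.ne', Int.emod_lt_of_pos _ hk0⟩, ?_⟩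
    have h1 : ((T.map ^ (k : ℤ)) ^ (n / k)) x = x :=
      Equiv.Perm.zpow_apply_eq_self_of_apply_eq_self (by rwa [zpow_natCast]) _
    change (T.map ^ (n % k)) x = (T.map ^ n) x
    conv_rhs => rw [← Int.emod_add_mul_ediv n k, zpow_add, zpow_mul, Equiv.Perm.mul_apply, h1]
  have h1 := hmin x hx
  rw [hfin.isClosed.closure_eq] at h1
  exact Set.Ico_infinite (hx.1.trans_lt hx.2) (hfin.subset h1)

/-! ### Complexity along orbits -/

variable {T} {d : ℕ}

theorem DefinedOver.add_sum_mem (hT : T.DefinedOver d) (F : Finset (Fin s)) :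
    T.left + ∑ i ∈ F, T.len i ∈ Set.range (sqrtdEmb d) :=
  add_mem_range_sqrtdEmb hT.1 ((sqrtdEmb d).range.sum_mem fun i _ => hT.2 i)

theorem DefinedOver.α_mem (hT : T.DefinedOver d) (i : Fin s) :
    T.α i ∈ Set.range (sqrtdEmb d) :=
  sub_mem_range_sqrtdEmb (hT.add_sum_mem _) (hT.add_sum_mem _)

/-- A bound for the complexity of one step of `T`. -/
noncomputable def stepBound (T : IET s) (d : ℕ) : ℝ := ∑ i, Psi d (T.α i)

/-- A bound for the complexity of the separation points and of the end points of the domain. -/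
noncomputable def endBound (T : IET s) (d : ℕ) : ℝ :=
  Psi d T.left + Psi d T.right + ∑ i, Psi d (T.γ i)

theorem stepBound_nonneg : 0 ≤ T.stepBound d := Finset.sum_nonneg fun _ _ => Psi_nonneg _

theorem endBound_nonneg : 0 ≤ T.endBound d :=
  add_nonneg (add_nonneg (Psi_nonneg _) (Psi_nonneg _)) (Finset.sum_nonneg fun _ _ => Psi_nonneg _)

theorem DefinedOver.map_pow_sub (hd : 2 ≤ d) (hsq : Squarefree d) (hT : T.DefinedOver d) (n : ℕ)
    {x : ℝ} (hx : x ∈ T.dom) :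
    (T.map ^ n) x - x ∈ Set.range (sqrtdEmb d) ∧
      Psi d ((T.map ^ n) x - x) ≤ n * T.stepBound d := by
  induction n with
  | zero =>
    refine ⟨⟨0, by simp⟩, ?_⟩
    simpa using (Psi_eq hd hsq 0 0).le
  | succ n ih =>
    obtain ⟨i, hi⟩ := T.exists_mem_I (T.map_pow_mem_dom n hx)
    have h1 : (T.map ^ (n + 1)) x - x = ((T.map ^ n) x - x) + T.α i := by
      rw [pow_succ', Equiv.Perm.mul_apply]
      have : T.map ((T.map ^ n) x) = (T.map ^ n) x + T.α i := T.toFun_of_mem hi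
      rw [this]
      ring
    have h2 : Psi d (T.α i) ≤ T.stepBound d :=
      Finset.single_le_sum (f := fun i => Psi d (T.α i)) (fun _ _ => Psi_nonneg _)
        (Finset.mem_univ i)
    rw [h1]
    refine ⟨add_mem_range_sqrtdEmb ih.1 (hT.α_mem i), ?_⟩
    have h3 := Psi_add_le hd hsq ih.1 (hT.α_mem i)
    rw [Nat.cast_succ]
    linarith [ih.2]

theorem DefinedOver.map_zpow_sub (hd : 2 ≤ d) (hsq : Squarefree d) (hT : T.DefinedOver d) (n : ℤ)
    {x : ℝ} (hx : x ∈ T.dom) :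
    (T.map ^ n) x - x ∈ Set.range (sqrtdEmb d) ∧
      Psi d ((T.map ^ n) x - x) ≤ n.natAbs * T.stepBound d := by
  obtain ⟨n, rfl | rfl⟩ := n.eq_nat_or_neg
  · exact hT.map_pow_sub hd hsq n hx
  · have h1 := hT.map_pow_sub hd hsq n (T.map_zpow_mem_dom (-(n : ℤ)) hx)
    have h2 : (T.map ^ n) ((T.map ^ (-(n : ℤ))) x) = x := by
      rw [← zpow_natCast, ← Equiv.Perm.mul_apply, ← zpow_add]
      simp
    rw [h2] at h1
    rw [← neg_sub, Psi_neg hd hsq h1.1, Int.natAbs_neg, Int.natAbs_natCast]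
    exact ⟨(sqrtdEmb d).range.neg_mem h1.1, h1.2⟩

theorem DefinedOver.endpoint (hd : 2 ≤ d) (hsq : Squarefree d) (hT : T.DefinedOver d) {m n : ℕ}
    {x : ℝ} (hx : x ∈ T.D m n ∪ {T.left, T.right}) :
    x ∈ Set.range (sqrtdEmb d) ∧
      Psi d x ≤ (m + n + 1) * (T.stepBound d + T.endBound d) := by
  have hS := T.stepBound_nonneg (d := d)
  have hE := T.endBound_nonneg (d := d)
  have hmn : (0 : ℝ) ≤ m + n := by positivity
  have hsum : 0 ≤ ∑ i, Psi d (T.γ i) := Finset.sum_nonneg fun _ _ => Psi_nonneg _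
  have hlarge : T.endBound d ≤ (m + n + 1) * (T.stepBound d + T.endBound d) := by
    nlinarith [mul_nonneg hmn hE, mul_nonneg hmn hS]
  have hl := Psi_nonneg (d := d) T.left
  have hr := Psi_nonneg (d := d) T.right
  rcases hx with hx | rfl | rfl
  · simp only [D, Set.mem_iUnion] at hx
    obtain ⟨e, he, -, ⟨j, rfl⟩, rfl⟩ := hx
    have hγ : T.γ j ∈ Set.range (sqrtdEmb d) := hT.add_sum_mem _
    obtain ⟨h1, h2⟩ := hT.map_zpow_sub hd hsq e (T.γ_mem_dom j)
    have h3 := add_mem_range_sqrtdEmb h1 hγ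
    have h4 := Psi_add_le hd hsq h1 hγ
    rw [sub_add_cancel] at h3 h4
    refine ⟨h3, ?_⟩
    have h5 : Psi d (T.γ j) ≤ T.endBound d := by
      have := Finset.single_le_sum (f := fun i => Psi d (T.γ i)) (fun _ _ => Psi_nonneg _)
        (Finset.mem_univ j)
      unfold endBound
      linarith
    have h6 : (e.natAbs : ℝ) ≤ m + n + 1 := by
      have := he.1
      have := he.2
      exact_mod_cast (by omega : e.natAbs ≤ m + n + 1)
    have h7 := mul_le_mul_of_nonneg_right h6 hS
    nlinarith [mul_nonneg hmn hE]
  · refine ⟨hT.1, le_trans ?_ hlarge⟩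
    unfold endBound
    linarith
  · refine ⟨hT.add_sum_mem _, le_trans ?_ hlarge⟩
    unfold endBound
    linarith

/-- The displacement of a point under `T ^ k` is a nonzero element of `ℤ[√d]` of complexity `O(k)`,
hence it is at least of order `1 / k`. -/
theorem DefinedOver.one_le_mul_abs_map_pow_sub (hd : 2 ≤ d) (hsq : Squarefree d)
    (hT : T.DefinedOver d) (hmin : T.IsMinimal) {k : ℕ} (hk : 0 < k) {x : ℝ} (hx : x ∈ T.dom) :
    1 ≤ (1 + √(d : ℝ)) * T.stepBound d * k * |(T.map ^ k) x - x| := by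
  obtain ⟨h1, h2⟩ := hT.map_pow_sub hd hsq k hx
  calc 1 ≤ (1 + √(d : ℝ)) * (|(T.map ^ k) x - x| * Psi d ((T.map ^ k) x - x)) :=
        one_le_abs_mul_Psi hd hsq h1 (sub_ne_zero.2 (hmin.pow_apply_ne hk hx))
    _ ≤ (1 + √(d : ℝ)) * (|(T.map ^ k) x - x| * (k * T.stepBound d)) := by gcongr
    _ = _ := by ring

end IET

theorem corollary4 (d : ℕ) (hd : 2 ≤ d) (hsq : Squarefree d) (s : ℕ) (T : IET s)
    (hT : T.DefinedOver d) (hmin : T.IsMinimal) :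
    (∀ J ∈ T.U, J ∈ T.algebra d) ∧
      ∃ c C : ℝ, 0 < c ∧ 0 < C ∧ ∀ J ∈ T.U, c ≤ PiSet d J ∧ PiSet d J ≤ C := by
  have hsub : ∀ {m n : ℕ} {t w : ℝ}, t ∈ T.D m n ∪ {T.left, T.right} →
      w ∈ T.D m n ∪ {T.left, T.right} → Set.Ico t w ⊆ T.dom := by
    have hlr : T.left ≤ T.right :=
      le_add_of_nonneg_right (Finset.sum_nonneg fun i _ => (T.len_pos i).le)
    have hIcc : ∀ {m n : ℕ} {x : ℝ}, x ∈ T.D m n ∪ {T.left, T.right} →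
        x ∈ Set.Icc T.left T.right := by
      rintro m n x (hx | rfl | rfl)
      · exact Set.Ico_subset_Icc_self (T.D_subset_dom m n hx)
      · exact ⟨le_rfl, hlr⟩
      · exact ⟨hlr, le_rfl⟩
    exact fun {_ _ _ _} ht hw => Set.Ico_subset_Ico (hIcc ht).1 (hIcc hw).2
  have hs0 : (0 : ℝ) < 1 + √(d : ℝ) := by positivity
  have hS := T.stepBound_nonneg (d := d)
  have hE := T.endBound_nonneg (d := d)
  obtain ⟨q, hq⟩ := exists_nat_ge
    (2 * (T.right - T.left) * ((1 + √(d : ℝ)) * T.stepBound d))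
  set B := T.stepBound d + T.endBound d with hB
  set L := 4 * q * (T.right - T.left) + (T.right - T.left) with hL
  refine ⟨fun J hJ => ?_, 1 / (2 * (1 + √(d : ℝ))), max 1 (B * L), by positivity,
    lt_max_of_lt_left one_pos, fun J hJ => ?_⟩
  · simp only [IET.U, Set.mem_iUnion] at hJ
    obtain ⟨m, n, t, w, htw, ht, hw, -, rfl⟩ := hJ
    refine ⟨hsub ht hw, {(t, w)}, ?_, by simp⟩
    simp only [Finset.mem_singleton, forall_eq]
    exact ⟨htw, (hT.endpoint hd hsq ht).1, (hT.endpoint hd hsq hw).1⟩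
  · simp only [IET.U, Set.mem_iUnion] at hJ
    obtain ⟨m, n, t, w, htw, ht, hw, hD, rfl⟩ := hJ
    obtain ⟨ht1, ht2⟩ := hT.endpoint hd hsq ht
    obtain ⟨hw1, hw2⟩ := hT.endpoint hd hsq hw
    have hwt : 0 < w - t := sub_pos.2 htw
    rw [PiSet_Ico htw]
    constructor
    · have h1 := one_le_abs_mul_Psi hd hsq (sub_mem_range_sqrtdEmb hw1 ht1) hwt.ne'
      have h2 : Psi d (w - t) ≤ 2 * max (Psi d t) (Psi d w) := by
        have := Psi_sub_le hd hsq hw1 ht1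
        linarith [le_max_left (Psi d t) (Psi d w), le_max_right (Psi d t) (Psi d w)]
      rw [abs_of_pos hwt] at h1
      rw [div_le_iff₀ (by positivity)]
      calc 1 ≤ (1 + √(d : ℝ)) * ((w - t) * Psi d (w - t)) := h1
        _ ≤ (1 + √(d : ℝ)) * ((w - t) * (2 * max (Psi d t) (Psi d w))) := by gcongr
        _ = _ := by ring
    · obtain ⟨a, ha, htr⟩ := T.exists_translatesUpTo_of_disjoint (hsub ht hw) hD
      have h1 := htr.mul_length_le (fun i x hx => T.map_pow_mem_dom i hx)
        (mul_nonneg hs0.le hS)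
        (fun k hk x hx => hT.one_le_mul_abs_map_pow_sub hd hsq hmin hk hx) hq hwt ha
      have h2 : w - t ≤ T.right - T.left := by
        obtain ⟨h3, h4⟩ := (Set.Ico_subset_Ico_iff htw).1 (hsub ht hw)
        linarith
      have h3 : ((m : ℝ) + n + 1) * (w - t) ≤ L := by
        push_cast at h1
        linarith
      refine le_max_of_le_right ?_
      calc (w - t) * max (Psi d t) (Psi d w) ≤ (w - t) * ((m + n + 1) * B) :=
            mul_le_mul_of_nonneg_left (max_le ht2 hw2) hwt.le
        _ = B * (((m : ℝ) + n + 1) * (w - t)) := by ring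
        _ ≤ B * L := mul_le_mul_of_nonneg_left h3 (add_nonneg hS hE)
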